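/- Let $\Gamma$ be a finite simplicial graph with vertex set $V$, and let $A_\Gamma$ be the right-angled Artin group generated by $V$ with relations $[v,w]=1$ for adjacent $v,w$. For $\Delta\subseteq V$, let $A_\Delta=\langle\Delta\rangle\le A_\Gamma$ be the corresponding special subgroup. An outer automorphism $\Phi$ of $A_\Gamma$ stabilises (resp. acts trivially on) a subgroup $B$ if some representative $\varphi$ of $\Phi$ satisfies $\varphi(B)=B$ (resp. $\varphi|_B=\mathrm{id}$). Write $\mathrm{lk}(v)$ for the set of vertices adjacent to $v$, and $\mathrm{st}(v)=\{v\}\cup\mathrm{lk}(v)$. Let $\mathrm{Out}^0(A_\Gamma)\le\mathrm{Out}(A_\Gamma)$ be the subgroup generated by all inversions $v\mapsto v^{-1}$, all transvections $v\mapsto vw$ with $v\neq w$ and $\mathrm{lk}(v)\subseteq\mathrm{st}(w)$, and all partial conjugations $x\mapsto vxv^{-1}$ $(x\in K)$, where $K$ is a union of connected components of $\Gamma\setminus\mathrm{st}(v)$ (in each case the remaining vertices are fixed). For families $\mathcal G,\mathcal H$ of special subgroups, let $\mathrm{Out}^0(A_\Gamma;\mathcal G,\mathcal H^t)$ be the group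 of all elements of $\mathrm{Out}^0(A_\Gamma)$ that stabilise every member of $\mathcal G$ and act trivially on every member of $\mathcal H$; groups of this form are called relative automorphism groups of $A_\Gamma$. The family $\mathcal G$ is saturated with respect to $(\mathcal G,\mathcal H)$ if it contains every proper special subgroup stabilised by $\mathrm{Out}^0(A_\Gamma;\mathcal G,\mathcal H^t)$. Write $v\le_{\mathcal G}w$ if $\mathrm{lk}(v)\subseteq\mathrm{st}(w)$ and every $A_\Delta\in\mathcal G$ with $v\in\Delta$ has $w\in\Delta$; this is a preorder. Let $\sim_{\mathcal G}$ be the induced equivalence relation and $T_{\mathcal G}$ the set of its classes. For $\mathcal G$ saturated with respect to $(\mathcal G,\mathcal H)$, the rank of $\mathrm{Out}^0(A_\Gamma;\mathcal G,\mathcal H^t)$ is $$\sum_{c\in T_{\mathcal G}}(|c|-1)=|V|-|T_{\mathcal G}|.$$ For a relative automorphism group $P$, the equation $\mathrm{rk}(P)=m$ means that $P=\mathrm{Out}^0(A_\Gamma;\mathcal G',\mathcal H'^t)$ for some $\mathcal G',\mathcal H'$ with $\mathcal G'$ saturated with respect to $(\mathcal G',\mathcal H')$, and that $|V|-|T_{\mathcal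 G'}|=m$ for every such pair. Let $O=\mathrm{Out}^0(A_\Gamma;\mathcal G,\mathcal H^t)$ with $\mathcal G$ saturated with respect to $(\mathcal G,\mathcal H)$, and let $r=\mathrm{rk}(O)=|V|-|T_{\mathcal G}|$. Fix an ordering $c=\{v_1,\dots,v_n\}$ of each class $c\in T_{\mathcal G}$. For $1\le j\le n-1$ put $$\Delta_c^j=\{v_1,\dots,v_j\}\cup\{w\in V: v_1\le_{\mathcal G}w,\ w\not\sim_{\mathcal G}v_1\}.$$ The set $\mathcal P(O)$ of maximal standard parabolic subgroups consists of all stabilisers $\mathrm{Stab}_O(A_{\Delta_c^j})$ with $c\in T_{\mathcal G}$ and $1\le j\le|c|-1$. For $1\le m\le r-1$, the set $\mathcal P_m(O)$ of rank-$m$ standard parabolic subgroups consists of all intersections of $r-m$ distinct elements of $\mathcal P(O)$. **Proposition (rank of parabolic subgroups).** For all $1\le m\le r-1$, every $P\in\mathcal P_m(O)$ is a relative automorphism group of $A_\Gamma$, and $\mathrm{rk}(P)=m$. Moreover, every $P\in\mathcal P(O)$ is a relative automorphism group of $A_\Gamma$, and $r\ge1$ and $\mathrm{rk}(P)=r-1$.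 -/

import Mathlib

namespace RAAG

universe u

/-! ### Outer automorphisms -/

section Outer

variable (A : Type u) [Group A]

/-- The group of inner automorphisms, as a subgroup of `Aut(A)`. -/
abbrev Inn : Subgroup (MulAut A) := (MulAut.conj : A →* MulAut A).range

instance inn_normal : (Inn A).Normal where
  conj_mem := by
    rintro _ ⟨a, rfl⟩ φ
    refine ⟨φ a, ?_⟩
    ext x
    simp [MulAut.conj_apply]

/-- The outer automorphism group `Out(A) = Aut(A) / Inn(A)`. -/
abbrev Out : Type u := MulAut A ⧸ Inn A

variable {A}

/-- The outer automorphism `[φ]` represented by `φ`. -/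
abbrev outMk (φ : MulAut A) : Out A := QuotientGroup.mk φ

/-- `Φ` stabilises `B ≤ A` if some representative `φ` of `Φ` satisfies `φ(B) = B`. -/
def Stabilises (Φ : Out A) (B : Subgroup A) : Prop :=
  ∃ φ : MulAut A, outMk φ = Φ ∧ B.map φ.toMonoidHom = B

/-- `Φ` acts trivially on `B ≤ A` if some representative of `Φ` restricts to the identity on `B`. -/
def ActsTrivially (Φ : Out A) (B : Subgroup A) : Prop :=
  ∃ φ : MulAut A, outMk φ = Φ ∧ ∀ b ∈ B, φ b = b

/-- The subgroup of `Out(A)` of all outer automorphisms that stabilise `B`. -/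
def stabOut (B : Subgroup A) : Subgroup (Out A) where
  carrier := {Φ | Stabilises Φ B}
  one_mem' := ⟨1, rfl, by ext x; simp [Subgroup.mem_map]⟩
  mul_mem' := by
    rintro _ _ ⟨φ, rfl, hφ⟩ ⟨ψ, rfl, hψ⟩
    refine ⟨φ * ψ, rfl, ?_⟩
    have h : (φ * ψ).toMonoidHom = φ.toMonoidHom.comp ψ.toMonoidHom := rfl
    rw [h, ← Subgroup.map_map, hψ, hφ]
  inv_mem' := by
    rintro _ ⟨φ, rfl, hφ⟩
    refine ⟨φ⁻¹, rfl, ?_⟩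
    have h : (φ⁻¹).toMonoidHom.comp φ.toMonoidHom = MonoidHom.id A := by
      ext x
      exact φ.symm_apply_apply x
    calc B.map (φ⁻¹).toMonoidHom = (B.map φ.toMonoidHom).map (φ⁻¹).toMonoidHom := by rw [hφ]
      _ = B := by rw [Subgroup.map_map, h, Subgroup.map_id]

/-- The subgroup of `Out(A)` of all outer automorphisms that act trivially on `B`. -/
def trivOut (B : Subgroup A) : Subgroup (Out A) where
  carrier := {Φ | ActsTrivially Φ B}
  one_mem' := ⟨1, rfl, fun _ _ => rfl⟩
  mul_mem' := by
    rintro _ _ ⟨φ, rfl, hφ⟩ ⟨ψ, rfl, hψ⟩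
    refine ⟨φ * ψ, rfl, fun b hb => ?_⟩
    rw [MulAut.mul_apply, hψ b hb, hφ b hb]
  inv_mem' := by
    rintro _ ⟨φ, rfl, hφ⟩
    refine ⟨φ⁻¹, rfl, fun b hb => ?_⟩
    conv_lhs => rw [← hφ b hb]
    exact φ.symm_apply_apply b

end Outer

/-! ### Right-angled Artin groups and `Out⁰` -/

section Artin

variable {V : Type u} (Γ : SimpleGraph V)

/-- The defining relators `[v, w]` of `A_Γ`, one for each pair of adjacent vertices. -/
def relators : Set (FreeGroup V) :=
  {r | ∃ v w : V, Γ.Adj v w ∧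
    r = FreeGroup.of v * FreeGroup.of w * (FreeGroup.of v)⁻¹ * (FreeGroup.of w)⁻¹}

/-- The right-angled Artin group `A_Γ`. -/
abbrev Artin : Type u := PresentedGroup (relators Γ)

/-- The generator of `A_Γ` given by a vertex. -/
abbrev gen (v : V) : Artin Γ := PresentedGroup.of v

/-- The special subgroup `A_Δ ≤ A_Γ` of a full subgraph, i.e. of a set `Δ` of vertices. -/
def special (Δ : Set V) : Subgroup (Artin Γ) := Subgroup.closure (gen Γ '' Δ)

/-- The link of a vertex. -/
def lk (v : V) : Set V := {w | Γ.Adj v w}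

/-- The star of a vertex. -/
def st (v : V) : Set V := insert v (lk Γ v)

/-- `φ` is the inversion `ι_v`. -/
def IsInversion (φ : MulAut (Artin Γ)) (v : V) : Prop :=
  φ (gen Γ v) = (gen Γ v)⁻¹ ∧ ∀ x, x ≠ v → φ (gen Γ x) = gen Γ x

/-- `φ` is the transvection `ρ_v^w`, where `v ≠ w` and `lk(v) ⊆ st(w)`. -/
def IsTransvection (φ : MulAut (Artin Γ)) (v w : V) : Prop :=
  v ≠ w ∧ lk Γ v ⊆ st Γ w ∧ φ (gen Γ v) = gen Γ v * gen Γ w ∧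
    ∀ x, x ≠ v → φ (gen Γ x) = gen Γ x

/-- `K` is a union of connected components of `Γ \ st(v)`. -/
def IsComponentUnion (v : V) (K : Set V) : Prop :=
  ∃ S : Set (Γ.induce (st Γ v)ᶜ).ConnectedComponent, K = Subtype.val '' (⋃ C ∈ S, C.supp)

/-- `φ` is the partial conjugation `π_K^v`, where `K` is a union of components of `Γ \ st(v)`. -/
def IsPartialConj (φ : MulAut (Artin Γ)) (v : V) (K : Set V) : Prop :=
  IsComponentUnion Γ v K ∧ (∀ x ∈ K, φ (gen Γ x) = gen Γ v * gen Γ x * (gen Γ v)⁻¹) ∧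
    ∀ x, x ∉ K → φ (gen Γ x) = gen Γ x

/-- The pure outer automorphism group `Out⁰(A_Γ)`, generated by all inversions, transvections and
partial conjugations. -/
def pureOut : Subgroup (Out (Artin Γ)) :=
  Subgroup.closure {Φ | ∃ φ : MulAut (Artin Γ), outMk φ = Φ ∧
    ((∃ v, IsInversion Γ φ v) ∨ (∃ v w, IsTransvection Γ φ v w) ∨ ∃ v K, IsPartialConj Γ φ v K)}

/-! ### Relative outer automorphism groups

A family of special subgroups of `A_Γ` is given by the set `𝒢 : Set (Set V)` of the vertex sets `Δ`
of its members `A_Δ` (distinct `Δ` have distinct `A_Δ`). -/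

/-- `Out⁰(A_Γ; 𝒢, ℋᵗ)`: the elements of `Out⁰(A_Γ)` that stabilise every member of `𝒢` and act
trivially on every member of `ℋ`. -/
def relOut (𝒢 ℋ : Set (Set V)) : Subgroup (Out (Artin Γ)) :=
  pureOut Γ ⊓ (⨅ Δ ∈ 𝒢, stabOut (special Γ Δ)) ⊓ (⨅ Δ ∈ ℋ, trivOut (special Γ Δ))

/-- `P` is a relative automorphism group of `A_Γ`. -/
def IsRelOut (P : Subgroup (Out (Artin Γ))) : Prop :=
  ∃ 𝒢 ℋ : Set (Set V), P = relOut Γ 𝒢 ℋ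

/-- `𝒢` is saturated with respect to `(𝒢, ℋ)`: it contains every proper special subgroup that is
stabilised by all of `Out⁰(A_Γ; 𝒢, ℋᵗ)`. -/
def Saturated (𝒢 ℋ : Set (Set V)) : Prop :=
  ∀ Δ : Set V, Δ ≠ Set.univ → (∀ Φ ∈ relOut Γ 𝒢 ℋ, Stabilises Φ (special Γ Δ)) → Δ ∈ 𝒢

/-- The stabiliser `Stab_O(A_Δ)`. -/
def stabIn (O : Subgroup (Out (Artin Γ))) (Δ : Set V) : Subgroup (Out (Artin Γ)) :=
  O ⊓ stabOut (special Γ Δ)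

/-! ### The `𝒢`-ordering and the rank -/

/-- The `𝒢`-ordering: `v ≤_𝒢 w` iff `lk(v) ⊆ st(w)` and every member of `𝒢` that contains `v` also
contains `w`. -/
def GLe (𝒢 : Set (Set V)) (v w : V) : Prop :=
  lk Γ v ⊆ st Γ w ∧ ∀ Δ ∈ 𝒢, v ∈ Δ → w ∈ Δ

theorem GLe.rfl' (𝒢 : Set (Set V)) (v : V) : GLe Γ 𝒢 v v :=
  ⟨Set.subset_insert _ _, fun _ _ h => h⟩

theorem GLe.trans' {𝒢 : Set (Set V)} {u v w : V} (h₁ : GLe Γ 𝒢 u v) (h₂ : GLe Γ 𝒢 v w) :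
    GLe Γ 𝒢 u w := by
  refine ⟨fun x hx => ?_, fun Δ hΔ h => h₂.2 Δ hΔ (h₁.2 Δ hΔ h)⟩
  rcases h₁.1 hx with rfl | hv
  · rcases h₂.1 (SimpleGraph.Adj.symm hx : Γ.Adj x u) with rfl | hw
    · exact Or.inr (hx)
    · rcases h₁.1 (SimpleGraph.Adj.symm hw : Γ.Adj u w) with rfl | hw'
      · exact Or.inl rfl
      · exact Or.inr (SimpleGraph.Adj.symm hw')
  · exact h₂.1 hv

/-- The equivalence relation `∼_𝒢` of the `𝒢`-ordering. -/
def gSetoid (𝒢 : Set (Set V)) : Setoid V where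
  r v w := GLe Γ 𝒢 v w ∧ GLe Γ 𝒢 w v
  iseqv :=
    { refl := fun v => ⟨GLe.rfl' Γ 𝒢 v, GLe.rfl' Γ 𝒢 v⟩
      symm := fun h => ⟨h.2, h.1⟩
      trans := fun h₁ h₂ => ⟨GLe.trans' Γ h₁.1 h₂.1, GLe.trans' Γ h₂.2 h₁.2⟩ }

/-- The set `T_𝒢` of `𝒢`-equivalence classes of vertices. -/
abbrev Classes (𝒢 : Set (Set V)) : Type u := Quotient (gSetoid Γ 𝒢)

/-- The vertices of a `𝒢`-equivalence class. -/
def classSet (𝒢 : Set (Set V)) (c : Classes Γ 𝒢) : Set V :=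
  {v | (Quotient.mk (gSetoid Γ 𝒢) v) = c}

/-- The number `∑_{c ∈ T_𝒢} (|c| - 1) = |V(Γ)| - |T_𝒢|` (never truncated, as `T_𝒢` is a quotient
of `V(Γ)`). It is the rank of `Out⁰(A_Γ; 𝒢, ℋᵗ)` if `𝒢` is saturated with respect to `(𝒢, ℋ)`. -/
noncomputable def rank (𝒢 : Set (Set V)) : ℕ := Nat.card V - Nat.card (Classes Γ 𝒢)

/-- `rk(P) = m`: the group `P` can be written as `Out⁰(A_Γ; 𝒢, ℋᵗ)` with `𝒢` saturated with respect
to `(𝒢, ℋ)`, and the rank computed from any such way of writing `P` is `m`. -/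
def HasRank (P : Subgroup (Out (Artin Γ))) (m : ℕ) : Prop :=
  (∃ 𝒢 ℋ : Set (Set V), Saturated Γ 𝒢 ℋ ∧ P = relOut Γ 𝒢 ℋ) ∧
    ∀ 𝒢 ℋ : Set (Set V), Saturated Γ 𝒢 ℋ → P = relOut Γ 𝒢 ℋ → rank Γ 𝒢 = m

/-! ### Standard parabolic subgroups -/

/-- The set `Γ_{≻ v}` of the vertices `w` with `v ≤_𝒢 w` and not `w ∼_𝒢 v`. -/
def above (𝒢 : Set (Set V)) (v : V) : Set V := {w | GLe Γ 𝒢 v w ∧ ¬ GLe Γ 𝒢 w v}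

/-- An ordering `c = {v_1, …, v_n}` of each `𝒢`-equivalence class `c`; here `v_{i+1}` is
the value at `i : Fin n`. -/
abbrev ClassOrdering (𝒢 : Set (Set V)) : Type u :=
  ∀ c : Classes Γ 𝒢, Fin (Nat.card (classSet Γ 𝒢 c)) ≃ classSet Γ 𝒢 c

/-- The vertex set `Δ_c^j = {v_1, …, v_j} ∪ Γ_{≻ c}`. -/
def parabolicSet (𝒢 : Set (Set V)) (e : ClassOrdering Γ 𝒢) (c : Classes Γ 𝒢) (j : ℕ) : Set V :=
  {x | ∃ i, i.val < j ∧ x = (e c i : V)} ∪ {x | ∃ v ∈ classSet Γ 𝒢 c, x ∈ above Γ 𝒢 v}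

/-- The set `𝒫(O)` of maximal standard parabolic subgroups `Stab_O(A_{Δ_c^j})`, `1 ≤ j ≤ |c| - 1`,
of `O = Out⁰(A_Γ; 𝒢, ℋᵗ)`. -/
def maxParabolics (𝒢 ℋ : Set (Set V)) (e : ClassOrdering Γ 𝒢) : Set (Subgroup (Out (Artin Γ))) :=
  {P | ∃ (c : Classes Γ 𝒢) (j : ℕ), 1 ≤ j ∧ j < Nat.card (classSet Γ 𝒢 c) ∧
    P = stabIn Γ (relOut Γ 𝒢 ℋ) (parabolicSet Γ 𝒢 e c j)}

/-- The set `𝒫_m(O)` of rank-`m` standard parabolic subgroups (`1 ≤ m ≤ rk(O) - 1`): all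
intersections of `rk(O) - m` distinct maximal standard parabolic subgroups of `O`. -/
def parabolics (𝒢 ℋ : Set (Set V)) (e : ClassOrdering Γ 𝒢) (m : ℕ) :
    Set (Subgroup (Out (Artin Γ))) :=
  {P | ∃ Q : Fin (rank Γ 𝒢 - m) → Subgroup (Out (Artin Γ)), Function.Injective Q ∧
    (∀ i, Q i ∈ maxParabolics Γ 𝒢 ℋ e) ∧ P = ⨅ i, Q i}

end Artin

end RAAG

namespace RAAG

/-! ### Transvections and the special subgroups they stabilise. -/

section Transvections

variable {V : Type*} {Γ : SimpleGraph V}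

/-! An intersection of k ≥ 1 maximal parabolics is again a relative automorphism group: adjoin the k
sets `Δ_c^j` to `𝒢`. For a saturated family the preorder depends only on the group
(`gLe_iff_of_saturated`), and for v ≠ w the relation v ≤ w puts the transvection v ↦ vw in the
group. Such a transvection cannot stabilise `A_Δ` when v ∈ Δ and w ∉ Δ. Hence the preorder of the
intersection is the old one restricted to pairs v ≤ w for which each adjoined set containing v
contains w (`gLe_relOut_union_range_iff`).

Each `Δ_c^j` is upward closed away from c and cuts c after its j-th vertex. Distinct subgroups give
distinct cuts, so k of them create exactly k new classes and the rank drops by k. -/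

theorem commute_gen {x y : V} (h : Γ.Adj x y) : Commute (gen Γ x) (gen Γ y) := by
  have h1 := PresentedGroup.one_of_mem (rels := relators Γ) ⟨x, y, h, rfl⟩
  simp only [map_mul, map_inv] at h1
  exact mul_inv_eq_iff_eq_mul.1 (mul_inv_eq_one.1 h1)

theorem commute_gen_of_mem_st {x y : V} (h : y ∈ st Γ x) : Commute (gen Γ y) (gen Γ x) := by
  rcases h with rfl | h
  · exact Commute.refl _
  · exact (commute_gen h).symm

theorem gen_mem_special {Δ : Set V} {x : V} (h : x ∈ Δ) : gen Γ x ∈ special Γ Δ :=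
  Subgroup.subset_closure ⟨x, h, rfl⟩

/-- A map of the generators into a group, sending adjacent vertices to commuting elements, extends
to the right-angled Artin group. -/
def liftHom {G : Type*} [Group G] (f : V → G) (hf : ∀ x y, Γ.Adj x y → Commute (f x) (f y)) :
    Artin Γ →* G :=
  PresentedGroup.toGroup (f := f) <| by
    rintro _ ⟨x, y, h, rfl⟩
    simp [(hf x y h).eq]

@[simp] theorem liftHom_gen {G : Type*} [Group G] (f : V → G)
    (hf : ∀ x y, Γ.Adj x y → Commute (f x) (f y)) (x : V) : liftHom f hf (gen Γ x) = f x :=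
  PresentedGroup.toGroup.of _

open Classical in
/-- The exponent sum of a generator. -/
noncomputable def exponentSum (w : V) : Artin Γ →* Multiplicative ℤ :=
  liftHom (fun x => if x = w then Multiplicative.ofAdd 1 else 1) fun _ _ _ => Commute.all _ _

theorem exponentSum_gen_self (w : V) :
    exponentSum w (gen Γ w) = Multiplicative.ofAdd 1 := by
  simp [exponentSum]

theorem exponentSum_gen_of_ne {x w : V} (h : x ≠ w) : exponentSum w (gen Γ x) = 1 := by
  simp [exponentSum, h]

theorem exponentSum_eq_one_of_mem_special {Δ : Set V} {w : V} (hw : w ∉ Δ) {a : Artin Γ}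
    (ha : a ∈ special Γ Δ) : exponentSum w a = 1 := by
  have : special Γ Δ ≤ (exponentSum w).ker := by
    refine (Subgroup.closure_le _).2 ?_
    rintro _ ⟨x, hx, rfl⟩
    exact exponentSum_gen_of_ne fun h => hw (h ▸ hx)
  exact this ha

open Classical in
/-- The endomorphism `v ↦ v wⁿ` fixing the other generators. -/
noncomputable def transvectionHom {v w : V} (h : lk Γ v ⊆ st Γ w) (n : ℤ) :
    Artin Γ →* Artin Γ :=
  liftHom (fun x => if x = v then gen Γ v * gen Γ w ^ n else gen Γ x) <| by
    have key : ∀ y, Γ.Adj v y → Commute (gen Γ v * gen Γ w ^ n) (gen Γ y) := fun y hy =>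
      (commute_gen hy).mul_left ((commute_gen_of_mem_st (h hy)).symm.zpow_left n)
    intro x y hxy
    rcases eq_or_ne x v with rfl | hx
    · simpa [hxy.ne'] using key y hxy
    · rcases eq_or_ne y v with rfl | hy
      · simpa [hx] using (key x hxy.symm).symm
      · simpa [hx, hy] using commute_gen hxy

theorem transvectionHom_gen_self {v w : V} (h : lk Γ v ⊆ st Γ w) (n : ℤ) :
    transvectionHom h n (gen Γ v) = gen Γ v * gen Γ w ^ n := by
  simp [transvectionHom]

theorem transvectionHom_gen_of_ne {v w x : V} (h : lk Γ v ⊆ st Γ w) (n : ℤ) (hx : x ≠ v) :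
    transvectionHom h n (gen Γ x) = gen Γ x := by
  simp [transvectionHom, hx]

theorem transvectionHom_comp {v w : V} (h : lk Γ v ⊆ st Γ w) (hvw : v ≠ w) {m n : ℤ}
    (hmn : m + n = 0) :
    (transvectionHom h m).comp (transvectionHom h n) = MonoidHom.id (Artin Γ) := by
  refine PresentedGroup.ext fun x => ?_
  rcases eq_or_ne x v with rfl | hx
  · rw [MonoidHom.comp_apply, transvectionHom_gen_self, map_mul, map_zpow,
      transvectionHom_gen_self, transvectionHom_gen_of_ne h m hvw.symm, mul_assoc, ← zpow_add, hmn]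
    simp
  · rw [MonoidHom.comp_apply, transvectionHom_gen_of_ne h n hx, transvectionHom_gen_of_ne h m hx]
    rfl

/-- The transvection `v ↦ v w`. -/
noncomputable def transvection {v w : V} (h : lk Γ v ⊆ st Γ w) (hvw : v ≠ w) : MulAut (Artin Γ) :=
  MonoidHom.toMulEquiv (transvectionHom h 1) (transvectionHom h (-1))
    (transvectionHom_comp h hvw (by norm_num)) (transvectionHom_comp h hvw (by norm_num))

theorem transvection_gen_self {v w : V} (h : lk Γ v ⊆ st Γ w) (hvw : v ≠ w) :
    transvection h hvw (gen Γ v) = gen Γ v * gen Γ w := by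
  have := transvectionHom_gen_self h 1
  rwa [zpow_one] at this

theorem transvection_gen_of_ne {v w x : V} (h : lk Γ v ⊆ st Γ w) (hvw : v ≠ w) (hx : x ≠ v) :
    transvection h hvw (gen Γ x) = gen Γ x :=
  transvectionHom_gen_of_ne h 1 hx

theorem outMk_transvection_mem_pureOut {v w : V} (h : lk Γ v ⊆ st Γ w) (hvw : v ≠ w) :
    outMk (transvection h hvw) ∈ pureOut Γ :=
  Subgroup.subset_closure ⟨_, rfl, Or.inr <| Or.inl ⟨v, w, hvw, h, transvection_gen_self h hvw,
    fun _ => transvection_gen_of_ne h hvw⟩⟩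

theorem special_le_comap_transvectionHom {v w : V} (h : lk Γ v ⊆ st Γ w) (n : ℤ) {Δ : Set V}
    (hΔ : v ∈ Δ → w ∈ Δ) : special Γ Δ ≤ (special Γ Δ).comap (transvectionHom h n) := by
  refine (Subgroup.closure_le _).2 ?_
  rintro _ ⟨x, hx, rfl⟩
  change transvectionHom h n (gen Γ x) ∈ special Γ Δ
  rcases eq_or_ne x v with rfl | hxv
  · rw [transvectionHom_gen_self]
    exact mul_mem (gen_mem_special hx) (zpow_mem (gen_mem_special (hΔ hx)) n)
  · rw [transvectionHom_gen_of_ne h n hxv]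
    exact gen_mem_special hx

theorem stabilises_transvection {v w : V} (h : lk Γ v ⊆ st Γ w) (hvw : v ≠ w) {Δ : Set V}
    (hΔ : v ∈ Δ → w ∈ Δ) : Stabilises (outMk (transvection h hvw)) (special Γ Δ) := by
  refine ⟨_, rfl, le_antisymm ?_ fun a ha => ?_⟩
  · exact Subgroup.map_le_iff_le_comap.2 (special_le_comap_transvectionHom h 1 hΔ)
  · exact ⟨(transvection h hvw).symm a, special_le_comap_transvectionHom h (-1) hΔ ha,
      (transvection h hvw).apply_symm_apply a⟩

/-- Exponent sums do not see conjugation, so every representative sends v to an element with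
w-exponent 1, whereas all of `A_Δ` has w-exponent 0 if w ∉ Δ. -/
theorem mem_of_stabilises_transvection {v w : V} (h : lk Γ v ⊆ st Γ w) (hvw : v ≠ w) {Δ : Set V}
    (hs : Stabilises (outMk (transvection h hvw)) (special Γ Δ)) (hv : v ∈ Δ) : w ∈ Δ := by
  by_contra hw
  obtain ⟨φ, hφ, hmap⟩ := hs
  obtain ⟨g, hg⟩ := QuotientGroup.eq.1 hφ.symm
  have hφg : φ = transvection h hvw * MulAut.conj g := by rw [hg]; group
  have hmem : φ (gen Γ v) ∈ special Γ Δ := hmap.le ⟨_, gen_mem_special hv, rfl⟩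
  have h1 := exponentSum_eq_one_of_mem_special hw hmem
  rw [hφg, MulAut.mul_apply, MulAut.conj_apply, map_mul, map_mul, map_inv, map_mul, map_mul,
    map_inv, mul_inv_cancel_comm, transvection_gen_self, map_mul, exponentSum_gen_self,
    exponentSum_gen_of_ne hvw, one_mul] at h1
  exact one_ne_zero (Multiplicative.ofAdd.injective h1)

theorem actsTrivially_transvection {v w : V} (h : lk Γ v ⊆ st Γ w) (hvw : v ≠ w) {Δ : Set V}
    (hΔ : v ∉ Δ) : ActsTrivially (outMk (transvection h hvw)) (special Γ Δ) := by
  refine ⟨_, rfl, fun b hb => ?_⟩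
  have : special Γ Δ ≤ (transvection h hvw).toMonoidHom.eqLocus (MonoidHom.id _) := by
    refine (Subgroup.closure_le _).2 ?_
    rintro _ ⟨x, hx, rfl⟩
    exact transvection_gen_of_ne h hvw fun hxv => hΔ (hxv ▸ hx)
  exact this hb

end Transvections

/-! ### Saturation and the preorder of a relative automorphism group. -/

section Relative

variable {V : Type*} {Γ : SimpleGraph V}

theorem mem_relOut {𝒢 ℋ : Set (Set V)} {Φ : Out (Artin Γ)} :
    Φ ∈ relOut Γ 𝒢 ℋ ↔ Φ ∈ pureOut Γ ∧ (∀ Δ ∈ 𝒢, Stabilises Φ (special Γ Δ)) ∧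
      ∀ Δ ∈ ℋ, ActsTrivially Φ (special Γ Δ) := by
  simp only [relOut, Subgroup.mem_inf, Subgroup.mem_iInf, and_assoc]
  rfl

theorem ActsTrivially.stabilises {A : Type*} [Group A] {Φ : Out A} {B C : Subgroup A}
    (h : ActsTrivially Φ C) (hB : B ≤ C) : Stabilises Φ B := by
  obtain ⟨φ, hφ, hC⟩ := h
  refine ⟨φ, hφ, le_antisymm ?_ fun b hb => ⟨b, hb, hC b (hB hb)⟩⟩
  rintro _ ⟨b, hb, rfl⟩
  change φ b ∈ B
  rwa [hC b (hB hb)]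

theorem special_mono {Δ Δ' : Set V} (h : Δ ⊆ Δ') : special Γ Δ ≤ special Γ Δ' :=
  Subgroup.closure_mono (Set.image_mono h)

/-- The transvections of a saturated relative automorphism group are given by the `𝒢`-ordering. -/
theorem outMk_transvection_mem_relOut {𝒢 ℋ : Set (Set V)} (hsat : Saturated Γ 𝒢 ℋ) {v w : V}
    (h : GLe Γ 𝒢 v w) (hvw : v ≠ w) : outMk (transvection h.1 hvw) ∈ relOut Γ 𝒢 ℋ := by
  refine mem_relOut.2 ⟨outMk_transvection_mem_pureOut _ _, fun Δ hΔ =>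
    stabilises_transvection _ _ (h.2 Δ hΔ), fun Δ hΔ => actsTrivially_transvection _ _ fun hv => ?_⟩
  -- Acting trivially on a subgroup containing v stabilises ⟨v⟩, so saturation puts {v} in `𝒢`, and
  -- then v ≤ w forces w = v.
  have hmem : ({v} : Set V) ∈ 𝒢 := by
    refine hsat _ (fun hu => hvw ?_) fun Φ hΦ =>
      ((mem_relOut.1 hΦ).2.2 Δ hΔ).stabilises (special_mono (Set.singleton_subset_iff.2 hv))
    have : w ∈ ({v} : Set V) := hu ▸ Set.mem_univ w
    exact this.symm
  exact hvw (h.2 _ hmem rfl).symm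

/-- For a saturated family, the `𝒢`-ordering only depends on the relative automorphism group. -/
theorem gLe_iff_of_saturated {𝒢 ℋ : Set (Set V)} (hsat : Saturated Γ 𝒢 ℋ) {v w : V} :
    GLe Γ 𝒢 v w ↔ lk Γ v ⊆ st Γ w ∧
      ∀ Δ : Set V, (∀ Φ ∈ relOut Γ 𝒢 ℋ, Stabilises Φ (special Γ Δ)) → v ∈ Δ → w ∈ Δ := by
  refine and_congr_right fun _ => ⟨fun h Δ hΔ hv => ?_, fun h Δ hΔ =>
    h Δ fun Φ hΦ => (mem_relOut.1 hΦ).2.1 Δ hΔ⟩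
  by_cases hu : Δ = Set.univ
  · exact hu ▸ Set.mem_univ w
  · exact h Δ (hsat Δ hu hΔ) hv

/-- Adjoining all stabilised special subgroups leaves the group unchanged, so nothing further
becomes stabilised. -/
theorem exists_saturated (𝒢 ℋ : Set (Set V)) :
    ∃ 𝒢' ℋ' : Set (Set V), Saturated Γ 𝒢' ℋ' ∧ relOut Γ 𝒢 ℋ = relOut Γ 𝒢' ℋ' := by
  have heq : relOut Γ 𝒢 ℋ =
      relOut Γ {Δ | ∀ Φ ∈ relOut Γ 𝒢 ℋ, Stabilises Φ (special Γ Δ)} ℋ := by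
    ext Φ
    refine ⟨fun h => mem_relOut.2 ⟨(mem_relOut.1 h).1, fun Δ hΔ => hΔ Φ h, (mem_relOut.1 h).2.2⟩,
      fun h => mem_relOut.2 ⟨(mem_relOut.1 h).1, fun Δ hΔ => (mem_relOut.1 h).2.1 Δ
        fun Ψ hΨ => (mem_relOut.1 hΨ).2.1 Δ hΔ, (mem_relOut.1 h).2.2⟩⟩
  refine ⟨_, ℋ, fun Δ _ hΔ => ?_, heq⟩
  rwa [← heq] at hΔ

/-- The index type must be nonempty: an empty infimum is all of `Out`, not O. -/
theorem iInf_stabIn_relOut {ι : Type*} [Nonempty ι] (𝒢 ℋ : Set (Set V)) (D : ι → Set V) :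
    ⨅ i, stabIn Γ (relOut Γ 𝒢 ℋ) (D i) = relOut Γ (𝒢 ∪ Set.range D) ℋ := by
  ext Φ
  have hstab : ∀ i, Φ ∈ stabOut (special Γ (D i)) ↔ Stabilises Φ (special Γ (D i)) :=
    fun i => Iff.rfl
  simp only [stabIn, Subgroup.mem_iInf, Subgroup.mem_inf, mem_relOut, hstab, forall_and,
    forall_const, Set.mem_union, or_imp, Set.forall_mem_range]
  tauto

end Relative

/-! ### Counting classes after cutting. -/

section Parabolic

variable {V : Type*} {Γ : SimpleGraph V} {𝒢 ℋ : Set (Set V)}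

theorem gSetoid_iff {v w : V} :
    (Quotient.mk (gSetoid Γ 𝒢) v) = Quotient.mk (gSetoid Γ 𝒢) w ↔
      GLe Γ 𝒢 v w ∧ GLe Γ 𝒢 w v :=
  Quotient.eq

theorem mk_ordering (e : ClassOrdering Γ 𝒢) (c : Classes Γ 𝒢)
    (i : Fin (Nat.card (classSet Γ 𝒢 c))) :
    Quotient.mk (gSetoid Γ 𝒢) (e c i : V) = c :=
  (e c i).2

theorem exists_eq_ordering (e : ClassOrdering Γ 𝒢) (v : V) : ∃ c i, (e c i : V) = v :=
  ⟨Quotient.mk _ v, (e _).symm ⟨v, rfl⟩, congrArg Subtype.val ((e _).apply_symm_apply _)⟩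

theorem card_classSet_pos [Finite V] (c : Classes Γ 𝒢) : 0 < Nat.card (classSet Γ 𝒢 c) := by
  obtain ⟨v, rfl⟩ := Quotient.exists_rep c
  have : Nonempty (classSet Γ 𝒢 (Quotient.mk _ v)) := ⟨⟨v, rfl⟩⟩
  exact Nat.card_pos

theorem ordering_mem_parabolicSet_iff (e : ClassOrdering Γ 𝒢) (c : Classes Γ 𝒢)
    (i : Fin (Nat.card (classSet Γ 𝒢 c))) (j : ℕ) :
    (e c i : V) ∈ parabolicSet Γ 𝒢 e c j ↔ i.val < j := by
  refine ⟨?_, fun h => Or.inl ⟨i, h, rfl⟩⟩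
  rintro (⟨i', hi', heq⟩ | ⟨v, hv, -, h⟩)
  · rwa [(e c).injective (Subtype.ext heq)]
  · exact absurd (gSetoid_iff.1 ((mk_ordering e c i).trans hv.symm)).1 h

theorem mem_parabolicSet_of_mk_ne (e : ClassOrdering Γ 𝒢) {c : Classes Γ 𝒢} {j : ℕ} {v w : V}
    (hc : Quotient.mk (gSetoid Γ 𝒢) v ≠ c) (hvw : GLe Γ 𝒢 v w)
    (hv : v ∈ parabolicSet Γ 𝒢 e c j) : w ∈ parabolicSet Γ 𝒢 e c j := by
  rcases hv with ⟨i, -, rfl⟩ | ⟨u, hu, h1, h2⟩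
  · exact absurd (mk_ordering e c i) hc
  · exact Or.inr ⟨u, hu, GLe.trans' Γ h1 hvw, fun h => h2 (GLe.trans' Γ hvw h)⟩

/-- Equivalence of vertices with respect to an intersection of maximal standard parabolics. -/
theorem gLe_relOut_union_range_iff {ι : Type*} (hsat : Saturated Γ 𝒢 ℋ) (D : ι → Set V)
    {𝒢' ℋ' : Set (Set V)} (hsat' : Saturated Γ 𝒢' ℋ')
    (hP : relOut Γ (𝒢 ∪ Set.range D) ℋ = relOut Γ 𝒢' ℋ') {v w : V} :
    GLe Γ 𝒢' v w ↔ GLe Γ 𝒢 v w ∧ ∀ i, v ∈ D i → w ∈ D i := by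
  rw [gLe_iff_of_saturated hsat', ← hP]
  refine ⟨fun h => ⟨⟨h.1, fun Δ hΔ => h.2 Δ fun Φ hΦ => (mem_relOut.1 hΦ).2.1 Δ (Or.inl hΔ)⟩,
    fun i => h.2 (D i) fun Φ hΦ => (mem_relOut.1 hΦ).2.1 _ (Or.inr ⟨i, rfl⟩)⟩,
    fun ⟨h, hD⟩ => ⟨h.1, fun Δ hΔ hv => ?_⟩⟩
  by_cases hvw : v = w
  · rwa [← hvw]
  -- The transvection v ↦ vw lies in the smaller group too, so any Δ stabilised by that group and
  -- containing v contains w.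
  have hmem := mem_relOut.1 (outMk_transvection_mem_relOut hsat h hvw)
  refine mem_of_stabilises_transvection h.1 hvw (hΔ _ (mem_relOut.2 ⟨hmem.1, ?_, hmem.2.2⟩)) hv
  rintro _ (hΔ' | ⟨i, rfl⟩)
  · exact hmem.2.1 _ hΔ'
  · exact stabilises_transvection _ _ (hD i)

/-- Each of the sets `Δ_c^j` splits one class into two. -/
theorem card_classes_relOut_union_range [Finite V] {ι : Type*} [Finite ι]
    (hsat : Saturated Γ 𝒢 ℋ) (e : ClassOrdering Γ 𝒢) (c : ι → Classes Γ 𝒢) (j : ι → ℕ)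
    (hinj : ∀ i i', c i = c i' → j i = j i' → i = i') (hj0 : ∀ i, 1 ≤ j i)
    (hj : ∀ i, j i < Nat.card (classSet Γ 𝒢 (c i))) {𝒢' ℋ' : Set (Set V)}
    (hsat' : Saturated Γ 𝒢' ℋ')
    (hP : relOut Γ (𝒢 ∪ Set.range fun i => parabolicSet Γ 𝒢 e (c i) (j i)) ℋ =
      relOut Γ 𝒢' ℋ') :
    Nat.card (Classes Γ 𝒢') = Nat.card (Classes Γ 𝒢) + Nat.card ι := by
  have hle : ∀ v w : V, GLe Γ 𝒢' v w ↔ GLe Γ 𝒢 v w ∧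
      ∀ i, v ∈ parabolicSet Γ 𝒢 e (c i) (j i) → w ∈ parabolicSet Γ 𝒢 e (c i) (j i) :=
    fun v w => gLe_relOut_union_range_iff hsat _ hsat' hP
  -- New classes are the intervals of old classes between consecutive cuts.
  have hclass : ∀ d d' k k', Quotient.mk (gSetoid Γ 𝒢') (e d k : V) =
      Quotient.mk (gSetoid Γ 𝒢') (e d' k' : V) ↔
      d = d' ∧ ∀ i, c i = d → (k.val < j i ↔ k'.val < j i) := by
    intro d d' k k'
    rw [gSetoid_iff, hle, hle]
    constructor
    · rintro ⟨⟨h1, h2⟩, h3, h4⟩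
      obtain rfl : d = d' :=
        (mk_ordering e d k).symm.trans ((gSetoid_iff.2 ⟨h1, h3⟩).trans (mk_ordering e d' k'))
      refine ⟨rfl, ?_⟩
      rintro i rfl
      have h5 := h2 i
      have h6 := h4 i
      rw [ordering_mem_parabolicSet_iff, ordering_mem_parabolicSet_iff] at h5 h6
      exact ⟨h5, h6⟩
    · rintro ⟨rfl, h⟩
      have h1 := gSetoid_iff.1 ((mk_ordering e d k).trans (mk_ordering e d k').symm)
      have h2 : ∀ i, (e d k : V) ∈ parabolicSet Γ 𝒢 e (c i) (j i) ↔
          (e d k' : V) ∈ parabolicSet Γ 𝒢 e (c i) (j i) := by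
        intro i
        by_cases hi : c i = d
        · have := h i hi
          subst hi
          rwa [ordering_mem_parabolicSet_iff, ordering_mem_parabolicSet_iff]
        · exact ⟨mem_parabolicSet_of_mk_ne e (by rw [mk_ordering]; exact Ne.symm hi) h1.1,
            mem_parabolicSet_of_mk_ne e (by rw [mk_ordering]; exact Ne.symm hi) h1.2⟩
      exact ⟨⟨h1.1, fun i => (h2 i).1⟩, h1.2, fun i => (h2 i).2⟩
  rw [← Nat.card_sum]
  symm
  -- Each interval is represented by its first vertex: index 0, or index `j i`, which counting from
  -- zero is the first vertex past the cut.
  refine Nat.card_eq_of_bijective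
    (Sum.elim (fun d => Quotient.mk (gSetoid Γ 𝒢') (e d ⟨0, card_classSet_pos d⟩ : V))
      fun i => Quotient.mk (gSetoid Γ 𝒢') (e (c i) ⟨j i, hj i⟩ : V)) ⟨?_, ?_⟩
  · rintro (d | i) (d' | i') h
    · exact congrArg Sum.inl ((hclass _ _ _ _).1 h).1
    · obtain ⟨rfl, h⟩ := (hclass _ _ _ _).1 h
      exact absurd ((h i' rfl).1 (hj0 i')) (lt_irrefl _)
    · obtain ⟨rfl, h⟩ := (hclass _ _ _ _).1 h
      exact absurd ((h i rfl).2 (hj0 i)) (lt_irrefl _)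
    · obtain ⟨hc, h⟩ := (hclass _ _ _ _).1 h
      refine congrArg Sum.inr (hinj i i' hc (le_antisymm ?_ ?_))
      · exact not_lt.1 fun hlt => lt_irrefl _ ((h i rfl).2 hlt)
      · exact not_lt.1 fun hlt => lt_irrefl _ ((h i' hc.symm).1 hlt)
  · intro q
    obtain ⟨v, rfl⟩ := Quotient.exists_rep q
    obtain ⟨d, k, rfl⟩ := exists_eq_ordering e v
    -- The interval containing index k begins at the last cut at or before k, or at 0 if there is
    -- none.
    by_cases hne : {i | c i = d ∧ j i ≤ k.val}.Nonempty
    · obtain ⟨i, ⟨rfl, hik⟩, hmax⟩ := (Set.toFinite _).exists_maximalFor j _ hne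
      refine ⟨Sum.inr i, (hclass _ _ _ _).2 ⟨rfl, fun i' hi' => ⟨fun h => ?_, hik.trans_lt⟩⟩⟩
      by_contra hk
      exact absurd (hmax ⟨hi', not_lt.1 hk⟩ h.le) (not_le.2 h)
    · refine ⟨Sum.inl d, (hclass _ _ _ _).2 ⟨rfl, fun i hi => ⟨fun _ => ?_, fun _ => hj0 i⟩⟩⟩
      by_contra hk
      exact hne ⟨i, hi, not_lt.1 hk⟩

theorem hasRank_iInf_maxParabolics [Finite V] {ι : Type*} [Finite ι] [Nonempty ι]
    (hsat : Saturated Γ 𝒢 ℋ) (e : ClassOrdering Γ 𝒢) (Q : ι → Subgroup (Out (Artin Γ)))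
    (hQ : Function.Injective Q) (hmem : ∀ i, Q i ∈ maxParabolics Γ 𝒢 ℋ e) :
    IsRelOut Γ (⨅ i, Q i) ∧ Nat.card ι ≤ rank Γ 𝒢 ∧
      HasRank Γ (⨅ i, Q i) (rank Γ 𝒢 - Nat.card ι) := by
  choose c j hj0 hj hQeq using hmem
  have hP : ⨅ i, Q i =
      relOut Γ (𝒢 ∪ Set.range fun i => parabolicSet Γ 𝒢 e (c i) (j i)) ℋ := by
    rw [← iInf_stabIn_relOut]
    exact iInf_congr hQeq
  have hinj : ∀ i i', c i = c i' → j i = j i' → i = i' := fun i i' h1 h2 =>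
    hQ (by rw [hQeq, hQeq i', h1, h2])
  have hcard : ∀ 𝒢' ℋ' : Set (Set V), Saturated Γ 𝒢' ℋ' → ⨅ i, Q i = relOut Γ 𝒢' ℋ' →
      Nat.card (Classes Γ 𝒢') = Nat.card (Classes Γ 𝒢) + Nat.card ι := fun 𝒢' ℋ' hs h =>
    card_classes_relOut_union_range hsat e c j hinj hj0 hj hs (hP.symm.trans h)
  obtain ⟨𝒢₁, ℋ₁, hsat₁, hP₁⟩ : ∃ 𝒢' ℋ' : Set (Set V), Saturated Γ 𝒢' ℋ' ∧
      ⨅ i, Q i = relOut Γ 𝒢' ℋ' := by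
    rw [hP]
    exact exists_saturated _ _
  refine ⟨⟨_, _, hP⟩, ?_, ⟨𝒢₁, ℋ₁, hsat₁, hP₁⟩, fun 𝒢' ℋ' hs h => ?_⟩
  · have h1 := hcard _ _ hsat₁ hP₁
    have h2 : Nat.card (Classes Γ 𝒢₁) ≤ Nat.card V :=
      Nat.card_le_card_of_surjective _ Quotient.mk_surjective
    rw [rank]
    omega
  · rw [rank, rank, hcard _ _ hs h]
    omega

end Parabolic

end RAAG

theorem mainTheorem9 {V : Type*} [Finite V] (Γ : SimpleGraph V) (𝒢 ℋ : Set (Set V))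
    (hsat : RAAG.Saturated Γ 𝒢 ℋ) (e : RAAG.ClassOrdering Γ 𝒢) :
    (∀ m : ℕ, 1 ≤ m → m < RAAG.rank Γ 𝒢 → ∀ P ∈ RAAG.parabolics Γ 𝒢 ℋ e m,
      RAAG.IsRelOut Γ P ∧ RAAG.HasRank Γ P m) ∧
    (∀ P ∈ RAAG.maxParabolics Γ 𝒢 ℋ e,
      RAAG.IsRelOut Γ P ∧ 1 ≤ RAAG.rank Γ 𝒢 ∧ RAAG.HasRank Γ P (RAAG.rank Γ 𝒢 - 1)) := by
  constructor
  · rintro m - hm P ⟨Q, hQ, hmem, rfl⟩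
    have : Nonempty (Fin (RAAG.rank Γ 𝒢 - m)) := ⟨⟨0, Nat.sub_pos_of_lt hm⟩⟩
    obtain ⟨h1, -, h3⟩ := RAAG.hasRank_iInf_maxParabolics hsat e Q hQ hmem
    rw [Nat.card_fin, Nat.sub_sub_self hm.le] at h3
    exact ⟨h1, h3⟩
  · intro P hP
    have h := RAAG.hasRank_iInf_maxParabolics hsat e (fun _ : Unit => P)
      (Function.injective_of_subsingleton _) fun _ => hP
    rwa [iInf_const, Nat.card_unique] at h
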